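/- Let $p$ be an odd prime, $K/\mathbb{Q}_p$ a finite extension with absolute value $|\cdot|$ normalised by $|\pi|=q_K^{-1}$ ($\pi$ a uniformiser, $q_K$ the size of the residue field), extended to the completion $\mathbb{C}_K$ of an algebraic closure of $K$. Let $g\ge 1$ and let $a_1=0,b_1,a_2,b_2,\dots,a_g,b_g\in K$ be $2g$ distinct elements, all different from $1$. Put $c_i=\frac{a_i+b_i}{2}$ and $r_i=\frac{b_i-a_i}{2}$, and assume that $$0<|b_1|<|a_2|\le|b_2|\le|a_3|\le\dots\le|b_g|<1,\qquad c_i\neq c_j\ \text{ and }\ \frac{|r_i|}{|c_i-c_j|}<1\quad\text{for all } i\ne j .$$ Let $s_i=\begin{pmatrix}c_i&r_i^2-c_i^2\\1&-c_i\end{pmatrix}$, $s_\infty=\begin{pmatrix}1&-2\\0&-1\end{pmatrix}$ in $\mathrm{PGL}_2(K)$, acting on $\mathbb{P}^1(\mathbb{C}_K)$ by Möbius transformations; let $\gamma_i=s_is_\infty$ and $\Gamma=\langle\gamma_1,\dots,\gamma_g\rangle\subset\mathrm{PGL}_2(K)$. Let $\partial B'_i=\{x\in\mathbb{C}_K: |x-(2-c_i)|=|r_i|\}$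 be the boundary of the disc $B'_i=\{x\in\mathbb{C}_K: |x-(2-c_i)|<|r_i|\}$. Let $q\in K$ with $|q|<1$ be such that $\frac{|r_i|}{|c_i-c_j|}\le|q|$ for all $i\neq j$; if $g=1$ (when there are no such pairs) assume instead that $|r_1|\le|q|$. Let $1\le i,j\le g$, and let $a\in\partial B'_i$ and $z\in\partial B'_j$ be distinct mod $\Gamma$, that is, $\gamma a\ne z$ for all $\gamma\in\Gamma$. Put $$Q_{ij}=\prod_{\gamma\in\Gamma}\frac{(z-\gamma a)(\gamma_jz-\gamma\gamma_ia)}{(z-\gamma\gamma_ia)(\gamma_jz-\gamma a)},\qquad Q^0_{ij}=\frac{(z-a)(\gamma_jz-\gamma_ia)}{(z-\gamma_ia)(\gamma_jz-a)},$$ $$Q^\alpha_{ij}=Q^0_{ij}\cdot\frac{(z-\gamma_j^{-1}a)(\gamma_jz-\gamma_j\gamma_ia)}{(z-\gamma_j^{-1}\gamma_ia)(\gamma_jz-\gamma_ja)} .$$ Then the product $Q_{ij}$ converges unconditionally in $\mathbb{C}_K$ to a nonzero limit, and $$\left|\frac{Q^\alpha_{ij}}{Q_{ij}}-1\right|\le|q|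 .$$ If $i\neq j$, the same inequality also holds for $$Q^0_{ij}\cdot\frac{(z-\gamma_j^{-1}a)(\gamma_jz-\gamma_ja)}{(z-\gamma_j^{-1}\gamma_ia)(\gamma_jz-\gamma_j\gamma_ia)}$$ in place of $Q^\alpha_{ij}$. -/

import Mathlib

open scoped MatrixGroups

/-! The complete algebraically closed field is `ℂ_[p]`; the finite extension `K` of `ℚ_[p]` is a
subfield of it that is finite over `ℚ_[p]` (so the completed algebraic closure of `K` is
`ℂ_[p]`). -/

namespace Mumford

noncomputable section

/-- `ℙ¹(F)` is `F ∪ {∞}`, on which `PGL₂(F)` acts by Möbius transformations; this is the action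
that Mathlib's action of `GL₂(F)` on `OnePoint F` induces on the quotient. -/
instance pglAction (F : Type*) [Field F] [DecidableEq F] : MulAction PGL(2, F) (OnePoint F) :=
  Matrix.ProjGenLinGroup.mulActionOfGL <| by
    intro u x
    induction x using OnePoint.rec with
    | infty => simp [OnePoint.smul_infty_eq_ite]
    | coe k => simp [OnePoint.smul_some_eq_ite]

/-- The `2 × 2` determinant of the homogeneous coordinates `[x : 1]` of `x ∈ F` and `[1 : 0]` of
`∞`: it is `x - y` for `x, y ∈ F`. A cross ratio of four points of `ℙ¹(F)` is a quotient of
products of these determinants. -/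
def diff {F : Type*} [Field F] : OnePoint F → OnePoint F → F
  | some x, some y => x - y
  | some _, none => -1
  | none, some _ => 1
  | none, none => 0

variable {p : ℕ} [Fact p.Prime]

/-- The absolute value of `ℂ_[p]` normalised with respect to `K`: a uniformiser `π` of `K` has
`|π| = 1 / #(residue field of K)`, equivalently `|p| = p ^ (-[K : ℚ_p])`. -/
def nabs (K : IntermediateField ℚ_[p] ℂ_[p]) (x : ℂ_[p]) : ℝ :=
  ‖x‖ ^ Module.finrank ℚ_[p] K

/-- The open disc `B(c, r)`. -/
def openDisc (K : IntermediateField ℚ_[p] ℂ_[p]) (c r : ℂ_[p]) : Set ℂ_[p] :=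
  {z | nabs K (z - c) < nabs K r}

/-- The closed disc attached to `B(c, r)`. -/
def closedDisc (K : IntermediateField ℚ_[p] ℂ_[p]) (c r : ℂ_[p]) : Set ℂ_[p] :=
  {z | nabs K (z - c) ≤ nabs K r}

/-- The boundary `∂B(c, r)`: the closed disc minus the open disc. -/
def discBoundary (K : IntermediateField ℚ_[p] ℂ_[p]) (c r : ℂ_[p]) : Set ℂ_[p] :=
  closedDisc K c r \ openDisc K c r

/-- The branch data `a₁ = 0, b₁, …, a_g, b_g` in `K` (together with `a_∞ = 1`, `b_∞ = ∞`) of a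
Whittaker group of rank `g`, under the standing assumptions made for such groups. The indices are
`0, …, g - 1`. -/
structure WhittakerData (K : IntermediateField ℚ_[p] ℂ_[p]) (g : ℕ) where
  /-- the points `a_i` -/
  a : Fin g → K
  /-- the points `b_i` -/
  b : Fin g → K
  /-- the `2g` finite points other than `1` are distinct -/
  distinct : Function.Injective (Sum.elim a b)
  a_ne_one : ∀ i, a i ≠ 1
  b_ne_one : ∀ i, b i ≠ 1
  /-- `a₁ = 0` -/
  a_first : ∀ i : Fin g, (i : ℕ) = 0 → a i = 0
  /-- `0 < |b₁|` -/
  b_first : ∀ i : Fin g, (i : ℕ) = 0 → 0 < nabs K (b i)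
  /-- `|b₁| < |a₂|` -/
  b_first_lt : ∀ i j : Fin g, (i : ℕ) = 0 → (j : ℕ) = 1 → nabs K (b i) < nabs K (a j)
  /-- `|a_i| ≤ |b_i|` for `2 ≤ i ≤ g` -/
  a_le_b : ∀ i : Fin g, 1 ≤ (i : ℕ) → nabs K (a i) ≤ nabs K (b i)
  /-- `|b_i| ≤ |a_{i+1}|` for `2 ≤ i < g` -/
  b_le_a : ∀ i j : Fin g, 1 ≤ (i : ℕ) → (j : ℕ) = i + 1 → nabs K (b i) ≤ nabs K (a j)
  /-- `|b_g| < 1` -/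
  b_last : ∀ i : Fin g, (i : ℕ) + 1 = g → nabs K (b i) < 1
  /-- the centres `c_i = (a_i + b_i) / 2` are distinct -/
  c_ne : ∀ i j, i ≠ j → (a i + b i) / 2 ≠ (a j + b j) / 2
  /-- `|r_i| / |c_i - c_j| < 1` for `i ≠ j`, where `r_i = (b_i - a_i) / 2` -/
  ratio_lt : ∀ i j, i ≠ j →
    nabs K (((b i - a i) / 2 : K) : ℂ_[p]) /
      nabs K (((a i + b i) / 2 - (a j + b j) / 2 : K) : ℂ_[p]) < 1

namespace WhittakerData

variable {K : IntermediateField ℚ_[p] ℂ_[p]} {g : ℕ} (D : WhittakerData K g)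

/-- `c_i = (a_i + b_i) / 2` -/
def c (i : Fin g) : K := (D.a i + D.b i) / 2

/-- `r_i = (b_i - a_i) / 2` -/
def r (i : Fin g) : K := (D.b i - D.a i) / 2

theorem r_ne_zero (i : Fin g) : D.r i ≠ 0 := by
  have h : D.b i ≠ D.a i := fun h => by
    have := @D.distinct (Sum.inr i) (Sum.inl i) h
    simp at this
  exact div_ne_zero (sub_ne_zero.2 h) two_ne_zero

/-- The involution `s_i` with matrix `(c_i, r_i² - c_i²; 1, -c_i)`, which fixes `a_i` and `b_i`. -/
def s (i : Fin g) : PGL(2, K) :=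
  .mk (Matrix.GeneralLinearGroup.mkOfDetNeZero
    !![D.c i, D.r i ^ 2 - D.c i ^ 2; 1, -D.c i] (by
      have h : D.c i * -D.c i - (D.r i ^ 2 - D.c i ^ 2) * 1 = -(D.r i ^ 2) := by ring
      rw [Matrix.det_fin_two_of, h]
      exact neg_ne_zero.2 (pow_ne_zero 2 (D.r_ne_zero i))))

/-- The involution `s_∞` with matrix `(1, -2; 0, -1)`, which fixes `1` and `∞`. -/
def sInfty (K : IntermediateField ℚ_[p] ℂ_[p]) : PGL(2, K) :=
  .mk (Matrix.GeneralLinearGroup.mkOfDetNeZero !![1, -2; 0, -1] (by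
    simp [Matrix.det_fin_two_of]))

/-- The generators `γ_i = s_i s_∞`. -/
def gen (i : Fin g) : PGL(2, K) := D.s i * sInfty K

/-- The Whittaker group `Γ = ⟨γ_1, …, γ_g⟩ ⊆ PGL₂(K)`. -/
def group : Subgroup PGL(2, K) := Subgroup.closure (Set.range D.gen)

open scoped Classical in
/-- The action of `PGL₂(K)` on `ℙ¹(ℂ_p)` by Möbius transformations. -/
def act (γ : PGL(2, K)) (x : OnePoint ℂ_[p]) : OnePoint ℂ_[p] :=
  Matrix.ProjGenLinGroup.map (algebraMap K ℂ_[p]) γ • x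

/-- `∂B'_i`, where `B'_i = s_∞(B(c_i, r_i)) = B(2 - c_i, r_i)`. -/
def boundary' (i : Fin g) : Set ℂ_[p] :=
  discBoundary K (2 - (D.c i : ℂ_[p])) (D.r i)

/-- The factor
`(z - γ a) (γ_j z - γ γ_i a) / ((z - γ γ_i a) (γ_j z - γ a))`
of the period `Q_ij` at `γ`, a cross ratio. -/
def factor (i j : Fin g) (a z : OnePoint ℂ_[p]) (γ : PGL(2, K)) : ℂ_[p] :=
  (diff z (act γ a) * diff (act (D.gen j) z) (act (γ * D.gen i) a)) /
    (diff z (act (γ * D.gen i) a) * diff (act (D.gen j) z) (act γ a))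

/-- The period `Q_ij`: the product of the factors over all `γ ∈ Γ`. -/
def period (i j : Fin g) (a z : OnePoint ℂ_[p]) : ℂ_[p] :=
  ∏' γ : D.group, D.factor i j a z γ

/-- `Q_ij^0`: the factor at the identity. -/
def period0 (i j : Fin g) (a z : OnePoint ℂ_[p]) : ℂ_[p] := D.factor i j a z 1

/-- `(z - γ_j⁻¹ a) / (z - γ_j⁻¹ γ_i a)` -/
def corr (i j : Fin g) (a z : OnePoint ℂ_[p]) : ℂ_[p] :=
  diff z (act (D.gen j)⁻¹ a) / diff z (act ((D.gen j)⁻¹ * D.gen i) a)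

/-- `(γ_j z - γ_j γ_i a) / (γ_j z - γ_j a)` -/
def corr' (i j : Fin g) (a z : OnePoint ℂ_[p]) : ℂ_[p] :=
  diff (act (D.gen j) z) (act (D.gen j * D.gen i) a) /
    diff (act (D.gen j) z) (act (D.gen j) a)

/-- `Q_ij^α = Q_ij^0 · (z - γ_j⁻¹ a) (γ_j z - γ_j γ_i a) / ((z - γ_j⁻¹ γ_i a) (γ_j z - γ_j a))` -/
def periodAlpha (i j : Fin g) (a z : OnePoint ℂ_[p]) : ℂ_[p] :=
  D.period0 i j a z * (D.corr i j a z * D.corr' i j a z)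

/-- The variant of `Q_ij^α` in which the second correction is inverted:
`Q_ij^0 · (z - γ_j⁻¹ a) (γ_j z - γ_j a) / ((z - γ_j⁻¹ γ_i a) (γ_j z - γ_j γ_i a))` -/
def periodAlphaInv (i j : Fin g) (a z : OnePoint ℂ_[p]) : ℂ_[p] :=
  D.period0 i j a z * (D.corr i j a z * (D.corr' i j a z)⁻¹)

end WhittakerData

end

end Mumford

/-! The generator `γ_i` maps the exterior of `B'_i` onto the disc `B_i = B(c_i, r_i)`, and the
boundary of `B'_i` to that of `B_i`. The `2g` discs `B_i`, `B'_i` are separated: each radius is at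
most `δ = |q|` times the distance to any other centre, since `2 - c_i - c_j` is a unit for odd `p`.

A factor of the period is a product of two ratios, one seen from `z ∈ ∂B'_j` and one from `γ_j z ∈
∂B_j`. Both compare the images under one reduced word of the boundary points `a` and `γ_i a`. Each
letter after the innermost contracts by `δ ^ 2` relative to the radii
(`norm_wordMap_sub_wordMap_le`), so the factors tend to `1`, and the ultrametric inequality turns
this into unconditional convergence to a nonzero limit (`exists_hasProd_of_tendsto_one`).

Every factor outside `{1, γ_j, γ_j⁻¹}` is within `δ` of `1` (`norm_factor_wordElt_sub_one_le`). At
`γ_j` and `γ_j⁻¹` one of the two ratios compares points in different discs and is within `δ` of `1`;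
the other is the correction in `Q^α`. For `i ≠ j` the correction at `γ_j` is itself within `δ` of
`1`, so it may be inverted. -/

open Filter Topology

/-! ### Ultrametric estimates near `1` and infinite products. -/

section Ultrametric

variable {F : Type*} [NormedField F] [IsUltrametricDist F]

theorem norm_sub_le_max_of_ultrametric (x y : F) : ‖x - y‖ ≤ max ‖x‖ ‖y‖ := by
  simpa [sub_eq_add_neg] using IsUltrametricDist.norm_add_le_max x (-y)

theorem norm_eq_norm_of_norm_sub_lt {x y : F} (h : ‖x - y‖ < ‖y‖) : ‖x‖ = ‖y‖ := by
  have h1 : ‖x - y‖ ≠ ‖y‖ := h.ne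
  have := IsUltrametricDist.norm_add_eq_max_of_norm_ne_norm h1
  rwa [sub_add_cancel, max_eq_right h.le] at this

theorem norm_eq_one_of_norm_sub_one_lt {x : F} (h : ‖x - 1‖ < 1) : ‖x‖ = 1 := by
  simpa using norm_eq_norm_of_norm_sub_lt (x := x) (y := 1) (by simpa using h)

/-- Closed balls of radius `δ < 1` around `1` are multiplicative groups, so no error accumulates
when estimates are multiplied or inverted. -/
theorem norm_mul_sub_one_le {x y : F} {δ : ℝ} (hδ : δ < 1) (hx : ‖x - 1‖ ≤ δ)
    (hy : ‖y - 1‖ ≤ δ) : ‖x * y - 1‖ ≤ δ := by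
  have h : x * y - 1 = x * (y - 1) + (x - 1) := by ring
  rw [h]
  refine (IsUltrametricDist.norm_add_le_max _ _).trans (max_le ?_ hx)
  rwa [norm_mul, norm_eq_one_of_norm_sub_one_lt (hx.trans_lt hδ), one_mul]

theorem norm_inv_sub_one_le {x : F} {δ : ℝ} (hδ : δ < 1) (hx : ‖x - 1‖ ≤ δ) :
    ‖x⁻¹ - 1‖ ≤ δ := by
  have h1 := norm_eq_one_of_norm_sub_one_lt (hx.trans_lt hδ)
  have h0 : x ≠ 0 := norm_ne_zero_iff.1 (by rw [h1]; exact one_ne_zero)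
  have h : x⁻¹ - 1 = -(x⁻¹ * (x - 1)) := by field_simp; ring
  rwa [h, norm_neg, norm_mul, norm_inv, h1, inv_one, one_mul]

theorem norm_prod_sub_one_le {ι : Type*} {f : ι → F} {δ : ℝ} (h0 : 0 ≤ δ) (hδ : δ < 1)
    (s : Finset ι) (hs : ∀ i ∈ s, ‖f i - 1‖ ≤ δ) : ‖∏ i ∈ s, f i - 1‖ ≤ δ := by
  classical
  induction s using Finset.induction_on with
  | empty => simpa using h0
  | insert i s hi ih =>
    rw [Finset.prod_insert hi]
    exact norm_mul_sub_one_le hδ (hs _ (Finset.mem_insert_self _ _))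
      (ih fun k hk => hs k (Finset.mem_insert_of_mem hk))

/-- A family of nonzero elements of a complete nonarchimedean field that tends to `1` is
unconditionally multipliable with nonzero product, and the product is close to any finite partial
product outside of which all factors are close to `1`. -/
theorem exists_hasProd_of_tendsto_one [CompleteSpace F] {ι : Type*} {f : ι → F}
    (hf : ∀ i, f i ≠ 0) (hlim : Tendsto f cofinite (𝓝 1)) {δ : ℝ} (h0 : 0 ≤ δ) (hδ : δ < 1)
    (T : Finset ι) (hT : ∀ i ∉ T, ‖f i - 1‖ ≤ δ) :
    ∃ P, HasProd f P ∧ P ≠ 0 ∧ ‖P / ∏ i ∈ T, f i - 1‖ ≤ δ := by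
  classical
  have hne : ∀ S : Finset ι, ∏ i ∈ S, f i ≠ 0 := fun S => Finset.prod_ne_zero_iff.2 fun i _ => hf i
  have key : ∀ ε : ℝ, 0 ≤ ε → ε < 1 → ∀ T₁ S : Finset ι, T₁ ⊆ S → (∀ i ∉ T₁, ‖f i - 1‖ ≤ ε) →
      ‖(∏ i ∈ S, f i) / ∏ i ∈ T₁, f i - 1‖ ≤ ε := by
    intro ε hε0 hε1 T₁ S hTS hε
    rw [← Finset.prod_sdiff hTS, mul_div_cancel_right₀ _ (hne T₁)]
    exact norm_prod_sub_one_le hε0 hε1 _ fun i hi => hε i (Finset.mem_sdiff.1 hi).2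
  -- Constancy of the norm past `T` converts relative errors into absolute ones and keeps the limit
  -- away from `0`.
  have hnorm : ∀ S : Finset ι, T ⊆ S → ‖∏ i ∈ S, f i‖ = ‖∏ i ∈ T, f i‖ := by
    intro S hS
    have := norm_eq_one_of_norm_sub_one_lt ((key δ h0 hδ T S hS hT).trans_lt hδ)
    rwa [norm_div, div_eq_one_iff_eq (norm_ne_zero_iff.2 (hne T))] at this
  set M := ‖∏ i ∈ T, f i‖ with hM
  have hMpos : 0 < M := norm_pos_iff.2 (hne T)
  have hC : CauchySeq fun S : Finset ι => ∏ i ∈ S, f i := by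
    rw [Metric.cauchySeq_iff']
    intro ε hε
    -- The bound `1 / 2` only ensures `η < 1`, as `key` requires.
    set η : ℝ := min (ε / (2 * M)) (1 / 2) with hη
    have hηpos : 0 < η := by positivity
    have hfin : {i | ¬ ‖f i - 1‖ ≤ η}.Finite := by
      have := (Metric.tendsto_nhds.1 hlim) η hηpos
      rw [Filter.eventually_cofinite] at this
      refine this.subset fun i hi h => hi ?_
      rw [dist_eq_norm] at h
      exact h.le
    refine ⟨T ∪ hfin.toFinset, fun S hS => ?_⟩
    have h1 := key η hηpos.le (lt_of_le_of_lt (min_le_right _ _) (by norm_num))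
      (T ∪ hfin.toFinset) S hS (by
        intro i hi
        by_contra h
        exact hi (Finset.mem_union_right _ (hfin.mem_toFinset.2 h)))
    rw [div_sub_one (hne _), norm_div, hnorm _ Finset.subset_union_left,
      div_le_iff₀ hMpos] at h1
    rw [dist_eq_norm]
    refine h1.trans_lt ?_
    calc η * M ≤ ε / (2 * M) * M := by gcongr; exact min_le_left _ _
      _ = ε / 2 := by field_simp
      _ < ε := half_lt_self hε
  obtain ⟨P, hP⟩ := cauchySeq_tendsto_of_complete hC
  refine ⟨P, hP, ?_, ?_⟩
  · have h2 : ‖P‖ = M := tendsto_nhds_unique (hP.norm)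
      (tendsto_const_nhds.congr' ((eventually_ge_atTop T).mono fun S hS => (hnorm S hS).symm))
    exact norm_pos_iff.1 (h2 ▸ hMpos)
  · exact le_of_tendsto ((hP.div_const _).sub_const 1).norm
      ((eventually_ge_atTop T).mono fun S hS => key δ h0 hδ T S hS hT)

end Ultrametric

/-! ### Contraction by reduced words on separated discs. -/

/-- Pairwise well separated discs of centres `center w` and radii `‖radius w.1‖`, indexed by the
letters `w` of the free group on `ι`. -/
structure SchottkyDiscs (F ι : Type*) [NormedField F] where
  /-- the centres of the discs -/
  center : ι × Bool → F
  /-- the radii of the discs, which are the same for a letter and its inverse -/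
  radius : ι → F
  /-- the separation constant -/
  δ : ℝ
  δ_nonneg : 0 ≤ δ
  δ_lt_one : δ < 1
  radius_ne_zero : ∀ k, radius k ≠ 0
  sep : ∀ v w, v ≠ w → ‖radius v.1‖ ≤ δ * ‖center v - center w‖

namespace SchottkyDiscs

/-- The inverse letter. -/
def flip {ι : Type*} (w : ι × Bool) : ι × Bool := (w.1, !w.2)

theorem flip_ne {ι : Type*} (w : ι × Bool) : w ≠ flip w := by
  intro h
  have := congrArg Prod.snd h
  simp [flip] at this

variable {F ι : Type*} [NormedField F] (S : SchottkyDiscs F ι)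

/-- The Möbius transformation that maps the exterior of the disc of `flip w` to the disc of `w`. -/
def letterMap (w : ι × Bool) (u : F) : F :=
  S.center w - S.radius w.1 ^ 2 / (u - S.center (flip w))

/-- The composition of the transformations attached to the letters of a word. -/
def wordMap (L : List (ι × Bool)) (u : F) : F := L.foldr S.letterMap u

@[simp] theorem wordMap_nil (u : F) : S.wordMap [] u = u := rfl

@[simp] theorem wordMap_cons (w : ι × Bool) (L : List (ι × Bool)) (u : F) :
    S.wordMap (w :: L) u = S.letterMap w (S.wordMap L u) := rfl

theorem radius_pos (k : ι) : 0 < ‖S.radius k‖ := norm_pos_iff.2 (S.radius_ne_zero k)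

theorem norm_letterMap_sub_center (w : ι × Bool) (u : F) :
    ‖S.letterMap w u - S.center w‖ = ‖S.radius w.1‖ ^ 2 / ‖u - S.center (flip w)‖ := by
  simp [letterMap]

theorem norm_letterMap_sub_center_of_eq {w : ι × Bool} {u : F}
    (h : ‖u - S.center (flip w)‖ = ‖S.radius w.1‖) :
    ‖S.letterMap w u - S.center w‖ = ‖S.radius w.1‖ := by
  have := S.radius_pos w.1
  rw [norm_letterMap_sub_center, h]
  field_simp

theorem norm_letterMap_sub_center_le {w : ι × Bool} {u : F} {η : ℝ}
    (h : ‖S.radius w.1‖ ≤ η * ‖u - S.center (flip w)‖) :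
    ‖S.letterMap w u - S.center w‖ ≤ η * ‖S.radius w.1‖ := by
  have hr := S.radius_pos w.1
  have hd : 0 < ‖u - S.center (flip w)‖ := by
    refine lt_of_le_of_ne (norm_nonneg _) fun h0 => ?_
    rw [← h0, mul_zero] at h
    exact hr.not_ge h
  rw [norm_letterMap_sub_center, div_le_iff₀ hd]
  nlinarith

theorem sep_lt {v w : ι × Bool} (h : v ≠ w) : ‖S.radius v.1‖ < ‖S.center v - S.center w‖ := by
  have hr := S.radius_pos v.1
  have h1 := S.sep v w h
  have h2 : 0 < ‖S.center v - S.center w‖ := by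
    refine lt_of_le_of_ne (norm_nonneg _) fun h0 => ?_
    rw [← h0, mul_zero] at h1
    exact hr.not_ge h1
  exact h1.trans_lt (by nlinarith [S.δ_lt_one])

theorem sep' {v w : ι × Bool} (h : v ≠ w) :
    ‖S.radius w.1‖ ≤ S.δ * ‖S.center v - S.center w‖ := by
  rw [norm_sub_rev]
  exact S.sep w v h.symm

variable [IsUltrametricDist F]

/-- Seen from the centre of another disc, a whole closed disc is at a single distance. -/
theorem norm_sub_center_of_ne {v w : ι × Bool} (h : v ≠ w) {u : F}
    (hu : ‖u - S.center v‖ ≤ ‖S.radius v.1‖) :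
    ‖u - S.center w‖ = ‖S.center v - S.center w‖ := by
  apply norm_eq_norm_of_norm_sub_lt
  rw [sub_sub_sub_cancel_right]
  exact hu.trans_lt (S.sep_lt h)

theorem ne_of_mem_of_ne {v w : ι × Bool} (h : v ≠ w) {u u' : F}
    (hu : ‖u - S.center v‖ ≤ ‖S.radius v.1‖) (hu' : ‖u' - S.center w‖ ≤ ‖S.radius w.1‖) :
    u ≠ u' := by
  rintro rfl
  rw [S.norm_sub_center_of_ne h hu, norm_sub_rev] at hu'
  exact (S.sep_lt h.symm).not_ge hu'

theorem norm_sub_le_of_mem {w : ι × Bool} {η : ℝ} {x y : F}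
    (hx : ‖x - S.center w‖ ≤ η) (hy : ‖y - S.center w‖ ≤ η) : ‖x - y‖ ≤ η := by
  rw [← sub_sub_sub_cancel_right x y (S.center w)]
  exact (norm_sub_le_max_of_ultrametric _ _).trans (max_le hx hy)

/-- The difference of the images is `r_w ^ 2 (x - y)` over a product of two distances to the pole,
both equal to `d`. One `δ` comes from `r_w ≤ δ d`, the other from `r_v ≤ δ d`. -/
theorem norm_letterMap_sub_letterMap_le {v w : ι × Bool} (hvw : v ≠ flip w) {x y : F} {η : ℝ}
    (hx : ‖x - S.center v‖ ≤ ‖S.radius v.1‖) (hy : ‖y - S.center v‖ ≤ ‖S.radius v.1‖)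
    (hxy : ‖x - y‖ ≤ η * ‖S.radius v.1‖) :
    ‖S.letterMap w x - S.letterMap w y‖ ≤ S.δ ^ 2 * η * ‖S.radius w.1‖ := by
  have dx := S.norm_sub_center_of_ne hvw hx
  have dy := S.norm_sub_center_of_ne hvw hy
  have hv := S.sep v _ hvw
  have hw : ‖S.radius w.1‖ ≤ S.δ * ‖S.center v - S.center (flip w)‖ := S.sep' (w := flip w) hvw
  set d := ‖S.center v - S.center (flip w)‖
  have hd : 0 < d := (S.radius_pos v.1).trans (S.sep_lt hvw)
  have hx0 : x - S.center (flip w) ≠ 0 := norm_pos_iff.1 (dx ▸ hd)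
  have hy0 : y - S.center (flip w) ≠ 0 := norm_pos_iff.1 (dy ▸ hd)
  have e : S.letterMap w x - S.letterMap w y =
      S.radius w.1 ^ 2 * (x - y) / ((x - S.center (flip w)) * (y - S.center (flip w))) := by
    unfold letterMap
    field_simp
    ring
  have hr := S.radius_pos w.1
  have hη : 0 ≤ η := by
    by_contra h
    have := S.radius_pos v.1
    nlinarith [norm_nonneg (x - y)]
  have hδ := S.δ_nonneg
  rw [e, norm_div, norm_mul, norm_mul, norm_pow, dx, dy, div_le_iff₀ (by positivity)]
  calc ‖S.radius w.1‖ ^ 2 * ‖x - y‖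
      ≤ ‖S.radius w.1‖ ^ 2 * (η * ‖S.radius v.1‖) := by gcongr
    _ = ‖S.radius w.1‖ * ‖S.radius w.1‖ * (η * ‖S.radius v.1‖) := by ring
    _ ≤ ‖S.radius w.1‖ * (S.δ * d) * (η * (S.δ * d)) := by gcongr
    _ = _ := by ring

theorem ne_flip_of_isReduced {w v : ι × Bool} {L : List (ι × Bool)}
    (h : FreeGroup.IsReduced (w :: v :: L)) : v ≠ flip w := by
  rintro rfl
  have := (FreeGroup.isReduced_cons_cons.1 h).1
  simp [flip] at this

/-- The image under a nonempty reduced word of a point on the boundary of a disc. -/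
theorem wordMap_mem {i : ι × Bool} {u : F} (hu : ‖u - S.center i‖ = ‖S.radius i.1‖)
    (L : List (ι × Bool)) : ∀ w : ι × Bool, FreeGroup.IsReduced (w :: L) →
    ‖S.radius w.1‖ ≤ ‖S.wordMap L u - S.center (flip w)‖ ∧
      ‖S.wordMap (w :: L) u - S.center w‖ ≤ ‖S.radius w.1‖ ∧
      (L ≠ [] ∨ w.1 ≠ i.1 → ‖S.wordMap (w :: L) u - S.center w‖ ≤ S.δ * ‖S.radius w.1‖) := by
  have aux : ∀ (v w : ι × Bool) (t : F), v ≠ flip w → ‖t - S.center v‖ ≤ ‖S.radius v.1‖ →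
      ‖S.radius w.1‖ ≤ ‖t - S.center (flip w)‖ ∧
      ‖S.letterMap w t - S.center w‖ ≤ S.δ * ‖S.radius w.1‖ := by
    intro v w t hvw ht
    have h : ‖S.radius w.1‖ ≤ S.δ * ‖S.center v - S.center (flip w)‖ := S.sep' (w := flip w) hvw
    rw [← S.norm_sub_center_of_ne hvw ht] at h
    refine ⟨h.trans ?_, S.norm_letterMap_sub_center_le h⟩
    exact mul_le_of_le_one_left (norm_nonneg _) S.δ_lt_one.le
  have hle : ∀ w : ι × Bool, S.δ * ‖S.radius w.1‖ ≤ ‖S.radius w.1‖ := fun w =>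
    mul_le_of_le_one_left (norm_nonneg _) S.δ_lt_one.le
  induction L with
  | nil =>
    intro w _
    -- The only case without gain: `w` carries the boundary of the disc of `flip w` to the boundary
    -- of its own disc.
    by_cases h : i = flip w
    · subst h
      have hu' : ‖u - S.center (flip w)‖ = ‖S.radius w.1‖ := hu
      refine ⟨hu'.ge, (S.norm_letterMap_sub_center_of_eq hu').le, ?_⟩
      simp [flip]
    · obtain ⟨h1, h2⟩ := aux i w u h hu.le
      exact ⟨h1, h2.trans (hle w), fun _ => h2⟩
  | cons v L ih =>
    intro w hw
    obtain ⟨h1, h2⟩ := aux v w (S.wordMap (v :: L) u) (ne_flip_of_isReduced hw)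
      (ih v (FreeGroup.isReduced_cons_cons.1 hw).2).2.1
    exact ⟨h1, h2.trans (hle w), fun _ => h2⟩

/-- The innermost letter only brings both points into one closed disc; each further letter
contributes `δ ^ 2`. Hence the exponent counts `L` and not `w :: L`. -/
theorem norm_wordMap_sub_wordMap_le {i i' : ι × Bool} {u u' : F}
    (hu : ‖u - S.center i‖ = ‖S.radius i.1‖) (hu' : ‖u' - S.center i'‖ = ‖S.radius i'.1‖)
    (L : List (ι × Bool)) : ∀ w : ι × Bool, FreeGroup.IsReduced (w :: L) →
    ‖S.wordMap (w :: L) u - S.wordMap (w :: L) u'‖ ≤ S.δ ^ (2 * L.length) * ‖S.radius w.1‖ := by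
  induction L with
  | nil =>
    intro w hw
    simpa using S.norm_sub_le_of_mem (S.wordMap_mem hu [] w hw).2.1 (S.wordMap_mem hu' [] w hw).2.1
  | cons v L ih =>
    intro w hw
    have hv := (FreeGroup.isReduced_cons_cons.1 hw).2
    have := S.norm_letterMap_sub_letterMap_le (ne_flip_of_isReduced hw)
      (S.wordMap_mem hu L v hv).2.1 (S.wordMap_mem hu' L v hv).2.1 (ih v hv)
    rwa [← pow_add, add_comm 2] at this

theorem norm_ratio_sub_one_le_of_ne {v w : ι × Bool} (hvw : v ≠ w) {x y z : F} {η : ℝ}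
    (hz : ‖z - S.center v‖ = ‖S.radius v.1‖) (hy : ‖y - S.center w‖ ≤ ‖S.radius w.1‖)
    (hη : 0 ≤ η) (hxy : ‖x - y‖ ≤ η * ‖S.radius w.1‖) :
    ‖(z - x) / (z - y) - 1‖ ≤ S.δ * η := by
  have h1 : ‖z - y‖ = ‖S.center v - S.center w‖ := by
    rw [← S.norm_sub_center_of_ne hvw hz.le]
    apply norm_eq_norm_of_norm_sub_lt
    rw [S.norm_sub_center_of_ne hvw hz.le, sub_sub_sub_cancel_left, norm_sub_rev]
    refine hy.trans_lt ?_
    rw [norm_sub_rev]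
    exact S.sep_lt hvw.symm
  have h2 : 0 < ‖z - y‖ := h1 ▸ (S.radius_pos v.1).trans (S.sep_lt hvw)
  rw [div_sub_one (norm_pos_iff.1 h2), sub_sub_sub_cancel_left, norm_div, div_le_iff₀ h2,
    norm_sub_rev, h1]
  have := S.sep' hvw
  calc _ ≤ _ := hxy
    _ ≤ η * (S.δ * ‖S.center v - S.center w‖) := by gcongr
    _ = _ := by ring

/-- Even if `z` bounds the same disc, `y` lies strictly inside it, so `‖z - y‖` is exactly the
radius. -/
theorem norm_ratio_sub_one_le_of_interior {v w : ι × Bool} {x y z : F} {η : ℝ}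
    (hz : ‖z - S.center v‖ = ‖S.radius v.1‖) (hy : ‖y - S.center w‖ ≤ S.δ * ‖S.radius w.1‖)
    (hη : 0 ≤ η) (hxy : ‖x - y‖ ≤ η * ‖S.radius w.1‖) :
    ‖(z - x) / (z - y) - 1‖ ≤ η := by
  have hr := S.radius_pos w.1
  by_cases hvw : v = w
  · subst hvw
    have h1 : ‖z - y‖ = ‖S.radius v.1‖ := by
      rw [← hz]
      apply norm_eq_norm_of_norm_sub_lt
      rw [sub_sub_sub_cancel_left, norm_sub_rev, hz]
      exact hy.trans_lt (mul_lt_of_lt_one_left hr S.δ_lt_one)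
    have h2 : 0 < ‖z - y‖ := h1 ▸ hr
    rwa [div_sub_one (norm_pos_iff.1 h2), sub_sub_sub_cancel_left, norm_div, div_le_iff₀ h2,
      norm_sub_rev, h1]
  · refine (S.norm_ratio_sub_one_le_of_ne hvw hz
      (hy.trans (mul_le_of_le_one_left hr.le S.δ_lt_one.le)) hη hxy).trans ?_
    exact mul_le_of_le_one_left hη S.δ_lt_one.le

section Ratio

variable {k : ι} {b b' : Bool} {u u' z : F} {v w : ι × Bool} {L : List (ι × Bool)}
  (hu : ‖u - S.center (k, b)‖ = ‖S.radius k‖) (hu' : ‖u' - S.center (k, b')‖ = ‖S.radius k‖)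
  (hz : ‖z - S.center v‖ = ‖S.radius v.1‖) (hw : FreeGroup.IsReduced (w :: L))

include hu hu' hz hw

theorem norm_ratio_wordMap_sub_one_le_pow (hL : L ≠ []) :
    ‖(z - S.wordMap (w :: L) u) / (z - S.wordMap (w :: L) u') - 1‖ ≤ S.δ ^ (2 * L.length) :=
  S.norm_ratio_sub_one_le_of_interior hz
    ((S.wordMap_mem (i := (k, b')) hu' L w hw).2.2 (Or.inl hL)) (pow_nonneg S.δ_nonneg _)
    (S.norm_wordMap_sub_wordMap_le (i := (k, b)) (i' := (k, b')) hu hu' L w hw)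

/-- The factor `δ` has two possible sources: the images lie in the shrunken disc of `w`, or that
disc is separated from the one bounded by `z`. -/
theorem norm_ratio_wordMap_sub_one_le (hL : L ≠ [] ∨ w ≠ v ∨ w.1 ≠ k) :
    ‖(z - S.wordMap (w :: L) u) / (z - S.wordMap (w :: L) u') - 1‖ ≤ S.δ := by
  obtain ⟨-, h1, h1'⟩ := S.wordMap_mem (i := (k, b)) hu L w hw
  obtain ⟨-, h2, h2'⟩ := S.wordMap_mem (i := (k, b')) hu' L w hw
  by_cases h : L ≠ [] ∨ w.1 ≠ k
  · exact S.norm_ratio_sub_one_le_of_interior hz (h2' h) S.δ_nonneg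
      (S.norm_sub_le_of_mem (h1' h) (h2' h))
  · push Not at h
    obtain ⟨rfl, hk⟩ := h
    have hwv : w ≠ v := by simpa [hk] using hL
    have := S.norm_ratio_sub_one_le_of_ne hwv.symm hz h2 zero_le_one
      (by simpa using S.norm_sub_le_of_mem h1 h2)
    rwa [mul_one] at this

end Ratio

end SchottkyDiscs

/-! ### The Whittaker group as a group acting on separated discs. -/

namespace Mumford

variable {p : ℕ} [Fact p.Prime] {K : IntermediateField ℚ_[p] ℂ_[p]}

section NormalizedAbsoluteValue

variable [FiniteDimensional ℚ_[p] K]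

theorem nabs_le_nabs_iff {x y : ℂ_[p]} : nabs K x ≤ nabs K y ↔ ‖x‖ ≤ ‖y‖ :=
  pow_le_pow_iff_left₀ (norm_nonneg _) (norm_nonneg _) Module.finrank_pos.ne'

theorem nabs_lt_nabs_iff {x y : ℂ_[p]} : nabs K x < nabs K y ↔ ‖x‖ < ‖y‖ :=
  pow_lt_pow_iff_left₀ (norm_nonneg _) (norm_nonneg _) Module.finrank_pos.ne'

theorem nabs_lt_one_iff {x : ℂ_[p]} : nabs K x < 1 ↔ ‖x‖ < 1 :=
  pow_lt_one_iff_of_nonneg (norm_nonneg _) Module.finrank_pos.ne'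

omit [FiniteDimensional ℚ_[p] K] in
theorem nabs_div (x y : ℂ_[p]) : nabs K x / nabs K y = nabs K (x / y) := by
  simp [nabs, div_pow]

theorem mem_discBoundary_iff {c r z : ℂ_[p]} : z ∈ discBoundary K c r ↔ ‖z - c‖ = ‖r‖ := by
  simp only [discBoundary, closedDisc, openDisc, Set.mem_sdiff, Set.mem_ofPred_eq,
    nabs_le_nabs_iff, nabs_lt_nabs_iff, not_lt]
  exact ⟨fun h => le_antisymm h.1 h.2, fun h => ⟨h.le, h.ge⟩⟩

end NormalizedAbsoluteValue

theorem norm_two_eq_one (hp : p ≠ 2) : ‖(2 : ℂ_[p])‖ = 1 := by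
  have h : ‖((2 : ℕ) : ℚ_[p])‖ = 1 := by
    rw [Padic.norm_natCast_eq_one_iff]
    exact (Nat.coprime_primes Fact.out Nat.prime_two).2 hp
  rwa [← norm_algebraMap' ℂ_[p], map_natCast] at h

theorem coe_two : ((2 : K) : ℂ_[p]) = 2 := map_ofNat (algebraMap K ℂ_[p]) 2

namespace WhittakerData

variable {g : ℕ} (D : WhittakerData K g)

theorem act_one (x : OnePoint ℂ_[p]) : act (1 : PGL(2, K)) x = x := by
  simp [act]

theorem act_mul (γ γ' : PGL(2, K)) (x : OnePoint ℂ_[p]) :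
    act (γ * γ') x = act γ (act γ' x) := by
  simp [act, mul_smul]

theorem act_inv_eq_iff {γ : PGL(2, K)} {x y : OnePoint ℂ_[p]} :
    act γ⁻¹ x = y ↔ x = act γ y := by
  simp [act, inv_smul_eq_iff]

theorem act_mkOfDetNeZero {M : Matrix (Fin 2) (Fin 2) K} (hM : M.det ≠ 0) {u : ℂ_[p]}
    (hu : (M 1 0 : ℂ_[p]) * u + M 1 1 ≠ 0) :
    act (.mk (Matrix.GeneralLinearGroup.mkOfDetNeZero M hM)) (u : OnePoint ℂ_[p]) =
      (((M 0 0 * u + M 0 1) / (M 1 0 * u + M 1 1) : ℂ_[p]) : OnePoint ℂ_[p]) := by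
  classical
  unfold act
  rw [Matrix.ProjGenLinGroup.map_mk]
  refine (Matrix.ProjGenLinGroup.mk_smul _ _ _).trans ?_
  rw [OnePoint.smul_some_eq_ite]
  exact if_neg hu

theorem act_s (i : Fin g) {u : ℂ_[p]} (hu : u ≠ D.c i) :
    act (D.s i) (u : OnePoint ℂ_[p]) =
      ((D.c i + D.r i ^ 2 / (u - D.c i) : ℂ_[p]) : OnePoint ℂ_[p]) := by
  have h0 : u - D.c i ≠ 0 := sub_ne_zero.2 hu
  unfold s
  rw [act_mkOfDetNeZero]
  · congr 1
    simp only [Matrix.of_apply, Matrix.cons_val', Matrix.cons_val_zero, Matrix.cons_val_one,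
      Matrix.cons_val_fin_one]
    push_cast
    rw [one_mul, ← sub_eq_add_neg]
    field_simp
    ring
  · simpa [← sub_eq_add_neg] using h0

theorem act_sInfty (u : ℂ_[p]) :
    act (sInfty K) (u : OnePoint ℂ_[p]) = ((2 - u : ℂ_[p]) : OnePoint ℂ_[p]) := by
  unfold sInfty
  rw [act_mkOfDetNeZero]
  · congr 1
    simp only [Matrix.of_apply, Matrix.cons_val', Matrix.cons_val_zero, Matrix.cons_val_one,
      Matrix.cons_val_fin_one]
    push_cast
    rw [coe_two]
    ring
  · simp

theorem act_gen (i : Fin g) {u : ℂ_[p]} (hu : u ≠ 2 - D.c i) :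
    act (D.gen i) (u : OnePoint ℂ_[p]) =
      ((D.c i - D.r i ^ 2 / (u - (2 - D.c i)) : ℂ_[p]) : OnePoint ℂ_[p]) := by
  have h : 2 - u ≠ D.c i := fun h => hu (by rw [← h]; ring)
  rw [gen, act_mul, act_sInfty, act_s D i h]
  congr 1
  rw [show 2 - u - (D.c i : ℂ_[p]) = -(u - (2 - D.c i)) by ring, div_neg, ← sub_eq_add_neg]

theorem act_gen_inv (i : Fin g) {u : ℂ_[p]} (hu : u ≠ D.c i) :
    act (D.gen i)⁻¹ (u : OnePoint ℂ_[p]) =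
      ((2 - D.c i - D.r i ^ 2 / (u - D.c i) : ℂ_[p]) : OnePoint ℂ_[p]) := by
  have h0 : u - D.c i ≠ 0 := sub_ne_zero.2 hu
  have hr : (D.r i : ℂ_[p]) ≠ 0 := by simpa using D.r_ne_zero i
  rw [act_inv_eq_iff, act_gen]
  · congr 1
    field_simp
    ring
  · intro h
    rw [sub_eq_self, div_eq_zero_iff] at h
    exact h.elim (pow_ne_zero 2 hr) h0

variable [FiniteDimensional ℚ_[p] K]

theorem norm_b_lt_one (i : Fin g) : ‖(D.b i : ℂ_[p])‖ < 1 := by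
  -- Descending induction from the last index; `n` is the number of indices after `i`.
  have h : ∀ n : ℕ, ∀ i : Fin g, (i : ℕ) + 1 + n = g → ‖(D.b i : ℂ_[p])‖ < 1 := by
    intro n
    induction n with
    | zero => exact fun i hi => nabs_lt_one_iff.1 (D.b_last i hi)
    | succ n ih =>
      intro i hi
      have hj := ih ⟨i + 1, by omega⟩ (by simp only; omega)
      have h1 := nabs_le_nabs_iff.1 (D.a_le_b ⟨i + 1, by omega⟩ (by simp))
      refine lt_of_le_of_lt (le_trans ?_ h1) hj
      rcases Nat.eq_zero_or_pos i with h0 | h0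
      · exact (nabs_lt_nabs_iff.1 (D.b_first_lt i ⟨i + 1, by omega⟩ h0 (by simp [h0]))).le
      · exact nabs_le_nabs_iff.1 (D.b_le_a i ⟨i + 1, by omega⟩ h0 rfl)
  exact h (g - (i + 1)) i (by omega)

theorem norm_a_lt_one (i : Fin g) : ‖(D.a i : ℂ_[p])‖ < 1 := by
  rcases Nat.eq_zero_or_pos i with h0 | h0
  · simp [D.a_first i h0]
  · exact (nabs_le_nabs_iff.1 (D.a_le_b i h0)).trans_lt (D.norm_b_lt_one i)

theorem norm_c_lt_one (hp : p ≠ 2) (i : Fin g) : ‖(D.c i : ℂ_[p])‖ < 1 := by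
  have h : (D.c i : ℂ_[p]) = (D.a i + D.b i) / 2 := by
    simp [c, coe_two]
  rw [h, norm_div, norm_two_eq_one hp, div_one]
  exact (IsUltrametricDist.norm_add_le_max _ _).trans_lt
    (max_lt (D.norm_a_lt_one i) (D.norm_b_lt_one i))

/-- As `p` is odd, `2` is a unit, while the `c_i` have norm below `1`. Thus every `B_i` is at
distance `1` from every `B'_j`, including `i = j`. -/
theorem norm_two_sub_c_sub_c (hp : p ≠ 2) (i j : Fin g) :
    ‖(2 : ℂ_[p]) - D.c i - D.c j‖ = 1 := by
  rw [← norm_two_eq_one hp]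
  apply norm_eq_norm_of_norm_sub_lt
  rw [norm_two_eq_one hp, show (2 : ℂ_[p]) - D.c i - D.c j - 2 = -(D.c i + D.c j) by ring, norm_neg]
  exact (IsUltrametricDist.norm_add_le_max _ _).trans_lt
    (max_lt (D.norm_c_lt_one hp i) (D.norm_c_lt_one hp j))

/-- The discs `B(c_i, r_i)` and `B(2 - c_i, r_i)` attached to the letters `γ_i` and `γ_i⁻¹`. -/
noncomputable def discs (hp : p ≠ 2) (q : K) (hq : ‖(q : ℂ_[p])‖ < 1)
    (hmax : ∀ i j : Fin g, i ≠ j →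
      ‖(D.r i : ℂ_[p])‖ ≤ ‖(q : ℂ_[p])‖ * ‖(D.c i : ℂ_[p]) - D.c j‖)
    (hle : ∀ i, ‖(D.r i : ℂ_[p])‖ ≤ ‖(q : ℂ_[p])‖) : SchottkyDiscs ℂ_[p] (Fin g) where
  center w := cond w.2 (D.c w.1 : ℂ_[p]) (2 - D.c w.1)
  radius i := D.r i
  δ := ‖(q : ℂ_[p])‖
  δ_nonneg := norm_nonneg _
  δ_lt_one := hq
  radius_ne_zero i := by simpa using D.r_ne_zero i
  sep := by
    rintro ⟨i, _ | _⟩ ⟨j, _ | _⟩ h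
    · have hij : i ≠ j := fun e => h (by rw [e])
      have e : (2 - D.c i - (2 - D.c j) : ℂ_[p]) = D.c j - D.c i := by ring
      simpa [e, norm_sub_rev (D.c j : ℂ_[p])] using hmax i j hij
    · simpa [D.norm_two_sub_c_sub_c hp i j] using hle i
    · have e : (D.c i - (2 - D.c j) : ℂ_[p]) = -(2 - D.c i - D.c j) := by ring
      simpa only [cond_true, cond_false, e, norm_neg, D.norm_two_sub_c_sub_c hp i j, mul_one]
        using hle i
    · have hij : i ≠ j := fun e => h (by rw [e])
      simpa using hmax i j hij

omit [FiniteDimensional ℚ_[p] K] in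
/-- The element of `Γ` attached to a word in the generators. -/
noncomputable def wordElt (L : List (Fin g × Bool)) : PGL(2, K) :=
  (L.map fun w => cond w.2 (D.gen w.1) (D.gen w.1)⁻¹).prod

omit [FiniteDimensional ℚ_[p] K] in
theorem gen_mem_group (i : Fin g) : D.gen i ∈ D.group := Subgroup.subset_closure ⟨i, rfl⟩

omit [FiniteDimensional ℚ_[p] K] in
theorem wordElt_mem_group (L : List (Fin g × Bool)) : D.wordElt L ∈ D.group := by
  refine list_prod_mem fun x hx => ?_
  obtain ⟨⟨i, b⟩, -, rfl⟩ := List.mem_map.1 hx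
  cases b
  · exact inv_mem (D.gen_mem_group i)
  · exact D.gen_mem_group i

omit [FiniteDimensional ℚ_[p] K] in
-- Existence of a reduced word suffices for the estimates; its uniqueness, that is freeness of `Γ`,
-- is never needed.
theorem exists_wordElt_eq {γ : PGL(2, K)} (hγ : γ ∈ D.group) :
    ∃ L, FreeGroup.IsReduced L ∧ D.wordElt L = γ := by
  rw [group, ← FreeGroup.range_lift_eq_closure] at hγ
  obtain ⟨x, rfl⟩ := hγ
  refine ⟨x.toWord, FreeGroup.isReduced_toWord, ?_⟩
  conv_rhs => rw [← FreeGroup.mk_toWord (x := x), FreeGroup.lift_mk]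
  rfl

section Periods

variable {D} {S : SchottkyDiscs ℂ_[p] (Fin g)}
  (hc : ∀ w, S.center w = cond w.2 (D.c w.1 : ℂ_[p]) (2 - D.c w.1))
  (hr : ∀ i, S.radius i = D.r i)

include hc hr

omit [FiniteDimensional ℚ_[p] K] in
theorem act_letter (w : Fin g × Bool) {u : ℂ_[p]} (hu : u ≠ S.center (SchottkyDiscs.flip w)) :
    act (cond w.2 (D.gen w.1) (D.gen w.1)⁻¹) (u : OnePoint ℂ_[p]) =
      (S.letterMap w u : OnePoint ℂ_[p]) := by
  obtain ⟨i, _ | _⟩ := w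
  · simp only [SchottkyDiscs.letterMap, hc, hr, SchottkyDiscs.flip] at hu ⊢
    exact D.act_gen_inv i hu
  · simp only [SchottkyDiscs.letterMap, hc, hr, SchottkyDiscs.flip] at hu ⊢
    exact D.act_gen i hu

omit [FiniteDimensional ℚ_[p] K] in
-- Along a reduced word the point stays at least a radius away from the pole of the next letter, so
-- `∞` never occurs.
theorem act_wordElt {k : Fin g × Bool} {u : ℂ_[p]} (hu : ‖u - S.center k‖ = ‖S.radius k.1‖)
    (L : List (Fin g × Bool)) (hL : FreeGroup.IsReduced L) :
    act (D.wordElt L) (u : OnePoint ℂ_[p]) = (S.wordMap L u : OnePoint ℂ_[p]) := by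
  induction L with
  | nil => exact act_one _
  | cons w L ih =>
    have h1 : D.wordElt (w :: L) = cond w.2 (D.gen w.1) (D.gen w.1)⁻¹ * D.wordElt L := by
      simp [wordElt]
    rw [h1, act_mul, ih (hL.infix (List.suffix_cons w L).isInfix), act_letter hc hr,
      SchottkyDiscs.wordMap_cons]
    intro h
    have := (S.wordMap_mem hu L w hL).1
    rw [h, sub_self, norm_zero] at this
    exact (S.radius_pos w.1).not_ge this

end Periods

end WhittakerData

end Mumford

/-! ### Factors of the period and the estimate. -/

namespace Mumford

namespace WhittakerData

variable {p : ℕ} [Fact p.Prime] {K : IntermediateField ℚ_[p] ℂ_[p]} {g : ℕ}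
  {D : WhittakerData K g} {S : SchottkyDiscs ℂ_[p] (Fin g)} {i j : Fin g} {a z : ℂ_[p]}

theorem diff_coe (x y : ℂ_[p]) : diff (x : OnePoint ℂ_[p]) (y : OnePoint ℂ_[p]) = x - y := rfl

section Periods

variable (hc : ∀ w, S.center w = cond w.2 (D.c w.1 : ℂ_[p]) (2 - D.c w.1))
  (hr : ∀ i, S.radius i = D.r i)
  (ha : ‖a - S.center (i, false)‖ = ‖S.radius i‖) (hz : ‖z - S.center (j, false)‖ = ‖S.radius j‖)

include hc hr ha

theorem act_gen_eq_letterMap :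
    act (D.gen i) (a : OnePoint ℂ_[p]) = (S.letterMap (i, true) a : OnePoint ℂ_[p]) := by
  refine act_letter hc hr (i, true) fun h => ?_
  rw [h] at ha
  exact (S.radius_pos i).ne (by simpa [SchottkyDiscs.flip] using ha)

/-- Treating `γ_i a` as a new starting point on `∂B_i` avoids any cancellation between the word and
`γ_i`. -/
theorem act_wordElt_mul_gen (L : List (Fin g × Bool)) (hL : FreeGroup.IsReduced L) :
    act (D.wordElt L * D.gen i) (a : OnePoint ℂ_[p]) =
      (S.wordMap L (S.letterMap (i, true) a) : OnePoint ℂ_[p]) := by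
  rw [act_mul, act_gen_eq_letterMap hc hr ha]
  exact act_wordElt hc hr (k := (i, true)) (S.norm_letterMap_sub_center_of_eq ha) L hL

include hz

theorem factor_wordElt (L : List (Fin g × Bool)) (hL : FreeGroup.IsReduced L) :
    D.factor i j a z (D.wordElt L) =
      ((z - S.wordMap L a) / (z - S.wordMap L (S.letterMap (i, true) a))) *
      ((S.letterMap (j, true) z - S.wordMap L (S.letterMap (i, true) a)) /
        (S.letterMap (j, true) z - S.wordMap L a)) := by
  rw [factor, act_wordElt_mul_gen hc hr ha L hL, act_gen_eq_letterMap hc hr hz,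
    act_wordElt hc hr (k := (i, false)) ha L hL]
  simp only [diff_coe]
  rw [mul_div_mul_comm]

omit hz in
theorem corr_eq :
    D.corr i j a z = (z - S.wordMap [(j, false)] a) /
      (z - S.wordMap [(j, false)] (S.letterMap (i, true) a)) := by
  have h : (D.gen j)⁻¹ = D.wordElt [(j, false)] := by simp [wordElt]
  rw [corr, h, act_wordElt_mul_gen hc hr ha _ FreeGroup.IsReduced.singleton,
    act_wordElt hc hr (k := (i, false)) ha _ FreeGroup.IsReduced.singleton, diff_coe, diff_coe]

theorem corr'_eq :
    D.corr' i j a z =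
      (S.letterMap (j, true) z - S.wordMap [(j, true)] (S.letterMap (i, true) a)) /
        (S.letterMap (j, true) z - S.wordMap [(j, true)] a) := by
  have h := act_wordElt_mul_gen hc hr ha _ (FreeGroup.IsReduced.singleton (a := (j, true)))
  have h' := act_wordElt hc hr (k := (i, false)) ha _ (FreeGroup.IsReduced.singleton (a := (j, true)))
  rw [show D.wordElt [(j, true)] = D.gen j by simp [wordElt]] at h h'
  rw [corr', h, h', act_gen_eq_letterMap hc hr hz, diff_coe, diff_coe]

/-- A zero would put `z` in the orbit of `a`, after applying `γ_j⁻¹` when it involves `γ_j z`. -/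
theorem sub_wordMap_ne_zero
    (haz : ∀ γ ∈ D.group, act γ (a : OnePoint ℂ_[p]) ≠ (z : OnePoint ℂ_[p]))
    (L : List (Fin g × Bool)) (hL : FreeGroup.IsReduced L) :
    z - S.wordMap L a ≠ 0 ∧ z - S.wordMap L (S.letterMap (i, true) a) ≠ 0 ∧
      S.letterMap (j, true) z - S.wordMap L a ≠ 0 ∧
      S.letterMap (j, true) z - S.wordMap L (S.letterMap (i, true) a) ≠ 0 := by
  have hL' := D.wordElt_mem_group L
  have hLi := mul_mem hL' (D.gen_mem_group i)
  have hj := inv_mem (D.gen_mem_group j)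
  have h1 := act_wordElt hc hr (k := (i, false)) ha L hL
  have h2 := act_wordElt_mul_gen hc hr ha L hL
  have h3 : act (D.gen j)⁻¹ (S.letterMap (j, true) z : OnePoint ℂ_[p]) = z := by
    rw [act_inv_eq_iff, act_gen_eq_letterMap hc hr hz]
  refine ⟨fun h => ?_, fun h => ?_, fun h => ?_, fun h => ?_⟩ <;> rw [sub_eq_zero] at h
  · exact haz _ hL' (by rw [h1, h])
  · exact haz _ hLi (by rw [h2, h])
  · exact haz _ (mul_mem hj hL') (by rw [act_mul, h1, ← h, h3])
  · exact haz _ (mul_mem hj hLi) (by rw [act_mul, h2, ← h, h3])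

theorem norm_factor_wordElt_sub_one_le {w : Fin g × Bool} {L : List (Fin g × Bool)}
    (hL : FreeGroup.IsReduced (w :: L)) (h : L ≠ [] ∨ w.1 ≠ j) :
    ‖D.factor i j a z (D.wordElt (w :: L)) - 1‖ ≤ S.δ := by
  have ha' := S.norm_letterMap_sub_center_of_eq (w := (i, true)) ha
  have hz' := S.norm_letterMap_sub_center_of_eq (w := (j, true)) hz
  rw [factor_wordElt hc hr ha hz _ hL]
  refine norm_mul_sub_one_le S.δ_lt_one
    (S.norm_ratio_wordMap_sub_one_le ha ha' (v := (j, false)) hz hL ?_)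
    (S.norm_ratio_wordMap_sub_one_le ha' ha hz' hL ?_) <;>
  exact h.imp_right fun h => Or.inl fun h' => h (by rw [h'])

theorem norm_factor_wordElt_sub_one_le_pow {w : Fin g × Bool} {L : List (Fin g × Bool)}
    (hL : FreeGroup.IsReduced (w :: L)) (h : L ≠ []) :
    ‖D.factor i j a z (D.wordElt (w :: L)) - 1‖ ≤ S.δ ^ (2 * L.length) := by
  have ha' := S.norm_letterMap_sub_center_of_eq (w := (i, true)) ha
  have hz' := S.norm_letterMap_sub_center_of_eq (w := (j, true)) hz
  rw [factor_wordElt hc hr ha hz _ hL]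
  have := List.length_pos_of_ne_nil h
  exact norm_mul_sub_one_le (pow_lt_one₀ S.δ_nonneg S.δ_lt_one (by omega))
    (S.norm_ratio_wordMap_sub_one_le_pow ha ha' (v := (j, false)) hz hL h)
    (S.norm_ratio_wordMap_sub_one_le_pow ha' ha hz' hL h)

theorem tendsto_factor :
    Tendsto (fun γ : D.group => D.factor i j a z γ) cofinite (𝓝 1) := by
  rw [Metric.tendsto_nhds]
  intro ε hε
  obtain ⟨N, hN⟩ := exists_pow_lt_of_lt_one hε S.δ_lt_one
  rw [Filter.eventually_cofinite]
  -- Finitely many letters give finitely many short words. A word of length above `N + 1` has a tail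
  -- longer than `N`, so its factor is within `δ ^ N` of `1`.
  refine (((List.finite_length_le (Fin g × Bool) (N + 1)).image D.wordElt).preimage
    Subtype.val_injective.injOn).subset ?_
  rintro ⟨γ, hγ⟩ h
  obtain ⟨L, hL, rfl⟩ := exists_wordElt_eq D hγ
  refine ⟨L, ?_, rfl⟩
  by_contra hlen
  simp only [Set.mem_ofPred_eq, not_le] at hlen
  refine h ?_
  obtain _ | ⟨w, L⟩ := L
  · simp at hlen
  · rw [List.length_cons] at hlen
    rw [dist_eq_norm]
    refine (norm_factor_wordElt_sub_one_le_pow hc hr ha hz hL ?_).trans_lt (lt_of_le_of_lt ?_ hN)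
    · rintro rfl
      simp at hlen
    · exact pow_le_pow_of_le_one S.δ_nonneg S.δ_lt_one.le (by omega)

omit ha in
-- Both `γ_j z` and `γ_j² z` lie in the closed disc of `γ_j`, which is disjoint from that of `γ_j⁻¹`
-- containing `z`. This makes `1, γ_j, γ_j⁻¹` three distinct indices of the product.
theorem gen_ne : D.gen j ≠ 1 ∧ D.gen j ≠ (D.gen j)⁻¹ := by
  have h1 := act_gen_eq_letterMap hc hr hz
  have hz' := S.norm_letterMap_sub_center_of_eq (w := (j, true)) hz
  constructor <;> intro h
  · rw [h, act_one, OnePoint.coe_eq_coe] at h1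
    exact S.ne_of_mem_of_ne (SchottkyDiscs.flip_ne (j, false)) hz.le hz'.le h1
  · have h2 := act_wordElt hc hr (k := (j, false)) hz [(j, true), (j, true)] (by simp)
    have h3 : D.wordElt [(j, true), (j, true)] = 1 := by
      simp only [wordElt, List.map_cons, List.map_nil, List.prod_cons, List.prod_nil, cond_true,
        mul_one]
      nth_rw 2 [h]
      exact mul_inv_cancel _
    rw [h3, act_one, OnePoint.coe_eq_coe] at h2
    exact S.ne_of_mem_of_ne (SchottkyDiscs.flip_ne (j, false)) hz.le
      (S.wordMap_mem (i := (j, false)) hz _ (j, true) (by simp)).2.1 h2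

theorem period_estimates
    (haz : ∀ γ ∈ D.group, act γ (a : OnePoint ℂ_[p]) ≠ (z : OnePoint ℂ_[p])) :
    Multipliable (fun γ : D.group => D.factor i j a z γ) ∧ D.period i j a z ≠ 0 ∧
      ‖D.periodAlpha i j a z / D.period i j a z - 1‖ ≤ S.δ ∧
      (i ≠ j → ‖D.periodAlphaInv i j a z / D.period i j a z - 1‖ ≤ S.δ) := by
  classical
  have ha' := S.norm_letterMap_sub_center_of_eq (w := (i, true)) ha
  have hz' := S.norm_letterMap_sub_center_of_eq (w := (j, true)) hz
  have hne := sub_wordMap_ne_zero hc hr ha hz haz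
  have hf : ∀ γ : D.group, D.factor i j a z γ ≠ 0 := by
    rintro ⟨γ, hγ⟩
    obtain ⟨L, hL, rfl⟩ := exists_wordElt_eq D hγ
    obtain ⟨h1, h2, h3, h4⟩ := hne L hL
    simp only [factor_wordElt hc hr ha hz L hL]
    exact mul_ne_zero (div_ne_zero h1 h2) (div_ne_zero h4 h3)
  obtain ⟨hg1, hg2⟩ := gen_ne hc hr hz
  let γ : D.group := ⟨D.gen j, D.gen_mem_group j⟩
  have hγ1 : (1 : D.group) ∉ ({γ, γ⁻¹} : Finset D.group) := by
    simp only [Finset.mem_insert, Finset.mem_singleton, eq_comm (a := (1 : D.group)), inv_eq_one,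
      or_self]
    exact fun h => hg1 (congrArg Subtype.val h)
  have hγ2 : γ ∉ ({γ⁻¹} : Finset D.group) := by
    rw [Finset.mem_singleton]
    exact fun h => hg2 (congrArg Subtype.val h)
  obtain ⟨P, hP, hP0, hPT⟩ := exists_hasProd_of_tendsto_one hf (tendsto_factor hc hr ha hz)
    S.δ_nonneg S.δ_lt_one {1, γ, γ⁻¹} (by
      rintro ⟨γ', hγ'⟩ hT
      obtain ⟨L, hL, rfl⟩ := exists_wordElt_eq D hγ'
      obtain _ | ⟨w, L⟩ := L
      · exact absurd (Finset.mem_insert_self _ _) hT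
      · refine norm_factor_wordElt_sub_one_le hc hr ha hz hL ?_
        by_contra! h
        obtain ⟨rfl, rfl⟩ := h
        apply hT
        obtain ⟨k, _ | _⟩ := w <;> simp [wordElt, Subtype.ext_iff, γ])
  have hperiod : D.period i j a z = P := hP.tprod_eq
  rw [Finset.prod_insert hγ1, Finset.prod_insert hγ2, Finset.prod_singleton] at hPT
  have e1 : D.wordElt [(j, true)] = (γ : PGL(2, K)) := by simp [wordElt, γ]
  have e2 : D.wordElt [(j, false)] = ((γ⁻¹ : D.group) : PGL(2, K)) := by simp [wordElt, γ]
  have f1 := factor_wordElt hc hr ha hz [(j, true)] (by simp)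
  have f2 := factor_wordElt hc hr ha hz [(j, false)] (by simp)
  rw [← corr'_eq hc hr ha hz, e1] at f1
  rw [← corr_eq hc hr ha, e2] at f2
  -- These are the halves of the factors at `γ_j` and `γ_j⁻¹` whose observer and images belong to
  -- opposite discs; they are close to `1` even when `i = j`.
  have u1 := S.norm_ratio_wordMap_sub_one_le ha ha' (v := (j, false)) hz
    (FreeGroup.IsReduced.singleton (a := (j, true))) (by simp)
  have u2 := S.norm_ratio_wordMap_sub_one_le ha' ha (v := (j, true)) hz'
    (FreeGroup.IsReduced.singleton (a := (j, false))) (by simp)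
  set U1 := (z - S.wordMap [(j, true)] a) /
    (z - S.wordMap [(j, true)] (S.letterMap (i, true) a))
  set U2 := (S.letterMap (j, true) z - S.wordMap [(j, false)] (S.letterMap (i, true) a)) /
    (S.letterMap (j, true) z - S.wordMap [(j, false)] a)
  have hf0 : D.period0 i j a z ≠ 0 := hf 1
  have hf1 := hf γ
  have hf2 := hf γ⁻¹
  rw [f1] at hf1
  rw [f2] at hf2
  obtain ⟨hU1, hc1⟩ := mul_ne_zero_iff.1 hf1
  obtain ⟨hc2, hU2⟩ := mul_ne_zero_iff.1 hf2
  have hα : ‖D.periodAlpha i j a z / P - 1‖ ≤ S.δ := by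
    have h := norm_inv_sub_one_le S.δ_lt_one
      (norm_mul_sub_one_le S.δ_lt_one hPT (norm_mul_sub_one_le S.δ_lt_one u1 u2))
    rw [f1, f2] at h
    have e : D.periodAlpha i j a z / P = (P / (D.period0 i j a z *
        (U1 * D.corr' i j a z * (D.corr i j a z * U2))) * (U1 * U2))⁻¹ := by
      rw [periodAlpha]
      field_simp
    rwa [e]
  refine ⟨hP.multipliable, hperiod ▸ hP0, hperiod ▸ hα, fun hij => ?_⟩
  -- For `i ≠ j`, `γ_j` moves `a` and `γ_i a` into the shrunken disc, away from `γ_j z` on its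
  -- boundary. Inverting this correction multiplies `Q^α` by its inverse square.
  have hinv : ‖(D.corr' i j a z)⁻¹ - 1‖ ≤ S.δ := by
    refine norm_inv_sub_one_le S.δ_lt_one ?_
    rw [corr'_eq hc hr ha hz]
    exact S.norm_ratio_wordMap_sub_one_le ha' ha (v := (j, true)) hz'
      FreeGroup.IsReduced.singleton (Or.inr (Or.inr hij.symm))
  have h := norm_mul_sub_one_le S.δ_lt_one hα (norm_mul_sub_one_le S.δ_lt_one hinv hinv)
  have e : D.periodAlphaInv i j a z / P = D.periodAlpha i j a z / P *
      ((D.corr' i j a z)⁻¹ * (D.corr' i j a z)⁻¹) := by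
    rw [periodAlpha, periodAlphaInv]
    field_simp
  rwa [hperiod, e]

end Periods

end WhittakerData

end Mumford

theorem mainTheorem7 (p : ℕ) [Fact p.Prime] (hp : p ≠ 2)
    (K : IntermediateField ℚ_[p] ℂ_[p]) [FiniteDimensional ℚ_[p] K]
    (g : ℕ) (D : Mumford.WhittakerData K g)
    (q : K) (hq : Mumford.nabs K q < 1)
    (hmax : ∀ i j : Fin g, i ≠ j →
      Mumford.nabs K (D.r i) / Mumford.nabs K ((D.c i : ℂ_[p]) - D.c j) ≤ Mumford.nabs K q)
    (hone : g = 1 → ∀ i, Mumford.nabs K (D.r i) ≤ Mumford.nabs K q)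
    (i j : Fin g) (a z : ℂ_[p]) (ha : a ∈ D.boundary' i) (hz : z ∈ D.boundary' j)
    (haz : ∀ γ ∈ D.group,
      Mumford.WhittakerData.act γ (a : OnePoint ℂ_[p]) ≠ (z : OnePoint ℂ_[p])) :
    Multipliable (fun γ : D.group => D.factor i j a z γ) ∧
      D.period i j a z ≠ 0 ∧
      Mumford.nabs K (D.periodAlpha i j a z / D.period i j a z - 1) ≤ Mumford.nabs K q ∧
      (i ≠ j →
        Mumford.nabs K (D.periodAlphaInv i j a z / D.period i j a z - 1) ≤
          Mumford.nabs K q) := by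
  have hmax' : ∀ i j : Fin g, i ≠ j →
      ‖(D.r i : ℂ_[p])‖ ≤ ‖(q : ℂ_[p])‖ * ‖(D.c i : ℂ_[p]) - D.c j‖ := by
    intro i j hij
    have h := hmax i j hij
    rw [Mumford.nabs_div, Mumford.nabs_le_nabs_iff, norm_div] at h
    refine (div_le_iff₀ (norm_pos_iff.2 (sub_ne_zero.2 fun h => ?_))).1 h
    exact D.c_ne i j hij (Subtype.ext h)
  have hle : ∀ i, ‖(D.r i : ℂ_[p])‖ ≤ ‖(q : ℂ_[p])‖ := by
    intro i
    by_cases hg : g = 1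
    · exact Mumford.nabs_le_nabs_iff.1 (hone hg i)
    -- With a second index `k`, `|c_i - c_k| ≤ 1` turns the ratio bound into `|r_i| ≤ |q|`; for `g =
    -- 1` this is assumed.
    · have : Nontrivial (Fin g) := Fin.nontrivial_iff_two_le.2 (by have := i.pos; omega)
      obtain ⟨k, hk⟩ := exists_ne i
      refine (hmax' i k hk.symm).trans (mul_le_of_le_one_right (norm_nonneg _) ?_)
      exact (norm_sub_le_max_of_ultrametric _ _).trans
        (max_le (D.norm_c_lt_one hp i).le (D.norm_c_lt_one hp k).le)
  rw [Mumford.nabs_lt_one_iff] at hq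
  simp only [Mumford.nabs_le_nabs_iff]
  exact Mumford.WhittakerData.period_estimates (S := D.discs hp q hq hmax' hle)
    (fun _ => rfl) (fun _ => rfl) (Mumford.mem_discBoundary_iff.1 ha)
    (Mumford.mem_discBoundary_iff.1 hz) haz
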